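/- **Corollary (SINR comparison of pure half-duplex and pure full-duplex two-tier networks).** *Network.* In the plane, the base stations (BSs) of tier $k\in\{1,2\}$ form independent homogeneous Poisson point processes $\Phi_1,\Phi_2$ of densities $\lambda_1,\lambda_2>0$; users have density $\lambda_u>0$. BSs of tier $k$ transmit with power $P_k>0$, users with power $P_u>0$; the residual self-interferences are $RSI_k\ge 0$ for BSs of tier $k$ and $RSI_u\ge 0$ for users; the noise power is $\sigma^2>0$; the path loss is $d^{-\alpha}$ with $\alpha>2$. For received power thresholds $\gamma_1,\gamma_2\in[0,\infty]$ put $\delta_k=(P_k/\gamma_k)^{1/\alpha}\in[0,\infty]$. Write $\bar k$ for the other tier and $D_k$ for the distance from the typical user (at the origin) to the closest BS of tier $k$. The typical user is a full-duplex (FD) user of tier $k$ if $D_k\le D_{\bar k}(P_k/P_{\bar k})^{1/\alpha}$ and $D_k\le\delta_k$, and a half-duplex (HD) user of tier $k$ if $D_k\le D_{\bar k}(P_k/P_{\bar k})^{1/\alpha}$ and $D_k>\delta_k$. These events have probabilities $\mathcal A_k^{\mathrm{FD}}$ and $\mathcal A_k^{\mathrm{HD}}$; the transmit distances $D_k^{\mathrm{FD}}$,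 $D_k^{\mathrm{HD}}$ have the law of $D_k$ conditioned on the respective event. Let $\lambda_t^{m}=\lambda_t\,\mathcal A_t^{m}/(\mathcal A_t^{\mathrm{FD}}+\mathcal A_t^{\mathrm{HD}})$ for $m\in\{\mathrm{FD},\mathrm{HD}\}$. *Interferers.* Consider a typical user of tier $k$, either on the downlink (D; the receiver is the typical user) or on the uplink (U; the receiver is its serving BS). Conditionally on the transmit distance being $r$, the interfering BSs and the interfering users of each tier $t$ and each mode $m$ are modelled as mutually independent Poisson processes in the plane. Their intensities depend only on the distance $y$ to the receiver and are as follows, with $\rho_{s,t}=(P_s/P_t)^{1/\alpha}$, $v=r+y$ for D and $v=y$ for U, and $\zeta=v/\max\{\rho_{k,t}-1,0\}$ (so $\zeta=\infty$ if the denominator is $0$). - FD BSs: $\lambda_t^{\mathrm{FD}}(1-e^{-\lambda_u\pi\zeta^2})$. HD BSs: $\lambda_t^{\mathrm{HD}}(1-e^{-\lambda_u\pi(\zeta^2-\delta_t^2)})$ if $\zeta>\delta_t$, and $0$ otherwise. For D these hold for $y\ge r\rho_{t,k}$, with intensity $0$ for smaller $y$. For U they hold for $y\ge r\rho_{t,k}+r$,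 and for smaller $y$ they are multiplied by $p^I_{k,t}=1-\bigl(P_t^{1/\alpha}/(P_t^{1/\alpha}+P_k^{1/\alpha})\bigr)^2$. - Users of mode $m$: $\lambda_t^{m}\bigl(1-e^{-\pi v^2\lambda_t(P_t/P_k)^{2/\alpha}}\bigr)$ for $y\ge y_0$, and $0$ for $y<y_0$. Here $y_0=\max\{r\rho_{t,k}-\delta_t,0\}$ (D, FD), $y_0=\max\{\delta_t\rho_{k,t}-r,0\}$ (D, HD), $y_0=\max\{(\rho_{t,k}-1)r-\delta_t,0\}$ (U, FD), $y_0=\rho_{k,t}\delta_t$ (U, HD). All fading coefficients are i.i.d. exponential with mean $1$ and independent of the locations. An interfering node at distance $y$ with fading $h$ contributes the power $P_t h y^{-\alpha}$ (BS of tier $t$) or $P_u h y^{-\alpha}$ (user). The interference $I^{1,\mathrm D}$, $I^{1,\mathrm U}$ on channel 1 is the total power from the FD BSs, FD users and HD BSs of both tiers. The interference $I^{2,\mathrm D}$, $I^{2,\mathrm U}$ on channel 2 is the total power from the FD BSs, FD users and HD users of both tiers. *SINR coverage.* With $h$ the fading of the useful signal, $$\theta_k^{i,\mathrm{FD,D}}=\frac{P_kh\,(D_k^{\mathrm{FD}})^{-\alpha}}{RSI_u+I^{i,\mathrm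 D}+\sigma^2},\qquad \theta_k^{i,\mathrm{FD,U}}=\frac{P_uh\,(D_k^{\mathrm{FD}})^{-\alpha}}{RSI_k+I^{i,\mathrm U}+\sigma^2},$$ $$\theta_k^{1,\mathrm{HD}}=\frac{P_kh\,(D_k^{\mathrm{HD}})^{-\alpha}}{I^{1,\mathrm D}+\sigma^2},\qquad \theta_k^{2,\mathrm{HD}}=\frac{P_uh\,(D_k^{\mathrm{HD}})^{-\alpha}}{I^{2,\mathrm U}+\sigma^2}.$$ For $\mathrm X\in\{\mathrm D,\mathrm U\}$ and $T\ge0$ let $$\mathcal C^{i,\mathrm{FD,X}}(T)=\frac{\sum_{k=1,2}\mathcal A_k^{\mathrm{FD}}\,\mathbb P(\theta_k^{i,\mathrm{FD,X}}>T)}{\sum_{k=1,2}\mathcal A_k^{\mathrm{FD}}},\qquad \mathcal C^{i,\mathrm{HD}}(T)=\frac{\sum_{k=1,2}\mathcal A_k^{\mathrm{HD}}\,\mathbb P(\theta_k^{i,\mathrm{HD}}>T)}{\sum_{k=1,2}\mathcal A_k^{\mathrm{HD}}}.$$ *Claim.* For every $T\ge 0$ and $i=1,2$, $$\mathcal C^{1,\mathrm{HD}}(T)\big|_{\gamma_1=\gamma_2=\infty}\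 \ge\ \mathcal C^{i,\mathrm{FD,D}}(T)\big|_{\gamma_1=\gamma_2=0},\qquad \mathcal C^{2,\mathrm{HD}}(T)\big|_{\gamma_1=\gamma_2=\infty}\ \ge\ \mathcal C^{i,\mathrm{FD,U}}(T)\big|_{\gamma_1=\gamma_2=0}.$$ -/

import Mathlib

open MeasureTheory ProbabilityTheory
open scoped ENNReal NNReal

namespace HetNet

noncomputable section

/-- The plane, with its Euclidean distance. -/
abbrev Plane := EuclideanSpace ℝ (Fin 2)

/-! ### Poisson point processes -/

/-- A point process in `E` on the sample space `Ω`, given by a measurable enumeration: at the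
outcome `ω` its points are `pt i ω` for `i < num ω` (repetitions count with multiplicity). -/
structure PointProcess (Ω : Type*) [MeasurableSpace Ω] (E : Type*) [MeasurableSpace E] where
  num : Ω → ℕ∞
  pt : ℕ → Ω → E
  measurable_num : Measurable num
  measurable_pt : ∀ i, Measurable (pt i)

namespace PointProcess

variable {Ω E : Type*} [MeasurableSpace Ω] [MeasurableSpace E]

/-- The number of points of the process that lie in `B`. -/
def count (Φ : PointProcess Ω E) (B : Set E) (ω : Ω) : ℕ∞ :=
  Set.encard {i : ℕ | (i : ℕ∞) < Φ.num ω ∧ Φ.pt i ω ∈ B}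

/-- The whole configuration of points, as a random element. -/
def config (Φ : PointProcess Ω E) (ω : Ω) : ℕ∞ × (ℕ → E) :=
  (Φ.num ω, fun i => Φ.pt i ω)

/-- Under `μ`, the process is Poisson with intensity measure `Λ`: the number of points in a
measurable set of finite intensity is Poisson distributed, and the numbers of points in pairwise
disjoint measurable sets are independent. -/
def IsPoisson (Φ : PointProcess Ω E) (μ : Measure Ω) (Λ : Measure E) : Prop :=
  (∀ B, MeasurableSet B → Λ B ≠ ∞ → ∀ n : ℕ,
    μ {ω | Φ.count B ω = n} = poissonMeasure (Λ B).toNNReal {n}) ∧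
  (∀ (n : ℕ) (B : Fin n → Set E), (∀ i, MeasurableSet (B i)) →
    Pairwise (fun i j => Disjoint (B i) (B j)) → iIndepFun (fun i => Φ.count (B i)) μ)

/-- Distance from the origin to the closest point of the process (`∞` if there is none). -/
def nearest (Φ : PointProcess Ω Plane) (ω : Ω) : ℝ≥0∞ :=
  ⨅ i : ℕ, if (i : ℕ∞) < Φ.num ω then ENNReal.ofReal ‖Φ.pt i ω‖ else ∞

end PointProcess

/-! ### The network -/

/-- Downlink or uplink. -/
inductive Link
  | down
  | up

/-- Duplex mode. -/
inductive Mode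
  | FD
  | HD

/-- Channel 1 (the downlink channel) and channel 2 (the uplink channel). -/
inductive Channel
  | ch1
  | ch2

/-- Kind of an interfering node. -/
inductive Node
  | bs
  | user

/-- Parameters of a two-tier network. Tiers are indexed by `Fin 2`. -/
structure Params where
  /-- density of the base stations of each tier -/
  lam : Fin 2 → ℝ
  /-- density of the users -/
  lamU : ℝ
  /-- transmit power of the base stations of each tier -/
  P : Fin 2 → ℝ
  /-- transmit power of the users -/
  PU : ℝ
  /-- residual self-interference of the base stations of each tier -/
  RSI : Fin 2 → ℝ
  /-- residual self-interference of the users -/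
  RSIU : ℝ
  /-- thermal noise power -/
  noise : ℝ
  /-- path loss exponent -/
  α : ℝ
  lam_pos : ∀ k, 0 < lam k
  lamU_pos : 0 < lamU
  P_pos : ∀ k, 0 < P k
  PU_pos : 0 < PU
  RSI_nonneg : ∀ k, 0 ≤ RSI k
  RSIU_nonneg : 0 ≤ RSIU
  noise_pos : 0 < noise
  two_lt_α : 2 < α

/-- The other tier. -/
def other (k : Fin 2) : Fin 2 := k.rev

namespace Params

variable (N : Params)

/-- `(P_s / P_t) ^ (1 / α)`. -/
def ratio (s t : Fin 2) : ℝ := (N.P s / N.P t) ^ (1 / N.α)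

/-- `δ_k = (P_k / γ_k) ^ (1 / α)`, the largest distance at which a user of tier `k` is
full-duplex when the received power thresholds are `γ`. It is `∞` for `γ_k = 0` and `0` for
`γ_k = ∞`. -/
def δ (γ : Fin 2 → ℝ≥0∞) (k : Fin 2) : ℝ≥0∞ :=
  (ENNReal.ofReal (N.P k) / γ k) ^ (1 / N.α)

/-- Power transmitted by an interfering node of tier `t`. -/
def nodePower (t : Fin 2) : Node → ℝ
  | .bs => N.P t
  | .user => N.PU

/-- Transmit power of the useful signal on a link between the typical user and its tagged base
station in tier `k`. -/
def signalPower (k : Fin 2) : Link → ℝ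
  | .down => N.P k
  | .up => N.PU

/-- Residual self-interference at the receiver of that link; a half-duplex node has none. -/
def selfInterference (k : Fin 2) : Link → Mode → ℝ
  | .down, .FD => N.RSIU
  | .up, .FD => N.RSI k
  | _, .HD => 0

end Params

/-- The base stations: independent homogeneous Poisson processes, one for each tier, seen from a
typical user at the origin. -/
structure BaseStations (N : Params) where
  Ω : Type*
  [mΩ : MeasurableSpace Ω]
  μ : Measure Ω
  [prob : IsProbabilityMeasure μ]
  Φ : Fin 2 → PointProcess Ω Plane
  poisson : ∀ k, (Φ k).IsPoisson μ (ENNReal.ofReal (N.lam k) • volume)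
  indep : iIndepFun (fun k => (Φ k).config) μ

attribute [instance] BaseStations.mΩ BaseStations.prob

namespace BaseStations

variable {N : Params} (S : BaseStations N)

/-- `D_k`, the distance from the typical user to its closest base station of tier `k`. -/
def D (k : Fin 2) : S.Ω → ℝ≥0∞ := (S.Φ k).nearest

/-- The event that the typical user belongs to tier `k` and is scheduled in mode `m`. -/
def assocEvent (γ : Fin 2 → ℝ≥0∞) (k : Fin 2) : Mode → Set S.Ω
  | .FD => {ω | S.D k ω ≤ S.D (other k) ω * ENNReal.ofReal (N.ratio k (other k)) ∧
      S.D k ω ≤ N.δ γ k}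
  | .HD => {ω | S.D k ω ≤ S.D (other k) ω * ENNReal.ofReal (N.ratio k (other k)) ∧
      N.δ γ k < S.D k ω}

/-- The association probabilities `A_k^FD` and `A_k^HD`. -/
def assocProb (γ : Fin 2 → ℝ≥0∞) (k : Fin 2) (m : Mode) : ℝ :=
  S.μ.real (S.assocEvent γ k m)

/-- The law of the transmit distance `D_k^FD` or `D_k^HD`: the law of `D_k` given that the typical
user belongs to tier `k` and is scheduled in mode `m`. -/
def distLaw (γ : Fin 2 → ℝ≥0∞) (k : Fin 2) (m : Mode) : Measure ℝ :=
  (S.μ[|S.assocEvent γ k m]).map fun ω => (S.D k ω).toReal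

/-- Density `λ_t^m = A_t^m / A_t * λ_t` of the base stations of tier `t` that schedule users of
mode `m`, where `A_t = A_t^FD + A_t^HD`. -/
def modeDensity (γ : Fin 2 → ℝ≥0∞) (t : Fin 2) (m : Mode) : ℝ :=
  S.assocProb γ t m / (S.assocProb γ t .FD + S.assocProb γ t .HD) * N.lam t

end BaseStations

/-! ### Intensities of the interfering nodes -/

/-- `1 - exp (-x)`, equal to `1` at `x = ∞`. -/
def oneSubExpNeg (x : ℝ≥0∞) : ℝ≥0∞ := 1 - EReal.exp (-(x : EReal))

/-- `ζ`: the distance between an interfering base station of tier `t`, at distance `y` from the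
receiver, and its handover point. It is `∞` when `P_k ≤ P_t` (and the numerator is positive). -/
def zeta (N : Params) (k t : Fin 2) (r y : ℝ) : Link → ℝ≥0∞
  | .down => ENNReal.ofReal (r + y) / ENNReal.ofReal (max (N.ratio k t - 1) 0)
  | .up => ENNReal.ofReal y / ENNReal.ofReal (max (N.ratio k t - 1) 0)

/-- The intensity functions `λ_{k,t}^{BS,m,D}`, `λ_{k,t}^{BS,m,U}`, `λ_{k,t}^{User,m,D}`,
`λ_{k,t}^{User,m,U}` at distance `y` from the receiver. -/
def intensityFn {N : Params} (S : BaseStations N) (γ : Fin 2 → ℝ≥0∞) (d : Link) (k t : Fin 2)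
    (r y : ℝ) : Node → Mode → ℝ≥0∞
  | .bs, .FD => ENNReal.ofReal (S.modeDensity γ t .FD) *
      oneSubExpNeg (ENNReal.ofReal (N.lamU * Real.pi) * zeta N k t r y d ^ 2)
  | .bs, .HD =>
      if zeta N k t r y d ≤ N.δ γ t then 0
      else ENNReal.ofReal (S.modeDensity γ t .HD) *
        oneSubExpNeg
          (ENNReal.ofReal (N.lamU * Real.pi) * (zeta N k t r y d ^ 2 - N.δ γ t ^ 2))
  | .user, m => ENNReal.ofReal (S.modeDensity γ t m) *
      oneSubExpNeg (ENNReal.ofReal (Real.pi *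
        (match d with
          | .down => r + y
          | .up => y) ^ 2 * N.lam t * (N.P t / N.P k) ^ (2 / N.α)))

/-- `p_{k,t}^I`. -/
def pI (N : Params) (k t : Fin 2) : ℝ :=
  1 - (N.P t ^ (1 / N.α) / (N.P t ^ (1 / N.α) + N.P k ^ (1 / N.α))) ^ 2

/-- The fraction of the circle of radius `y` around the receiver in which interfering nodes can be
located. In the uplink, the part of the plane without interfering base stations is a sector of the
disc of radius `Δ_{k,t}(r) + r`, which leaves the fraction `p_{k,t}^I` of the smaller circles. In
all other cases nodes are found exactly beyond a minimal distance. -/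
def allowedFraction (N : Params) (γ : Fin 2 → ℝ≥0∞) (d : Link) (k t : Fin 2) (r y : ℝ)
    (n : Node) (m : Mode) : ℝ≥0∞ :=
  match d, n, m with
  | .down, .bs, _ => if r * N.ratio t k ≤ y then 1 else 0
  | .down, .user, .FD =>
      if ENNReal.ofReal (r * N.ratio t k) - N.δ γ t ≤ ENNReal.ofReal y then 1 else 0
  | .down, .user, .HD =>
      if N.δ γ t * ENNReal.ofReal (N.ratio k t) - ENNReal.ofReal r ≤ ENNReal.ofReal y
      then 1 else 0
  | .up, .bs, _ => if r * N.ratio t k + r ≤ y then 1 else ENNReal.ofReal (pI N k t)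
  | .up, .user, .FD =>
      if ENNReal.ofReal ((N.ratio t k - 1) * r) - N.δ γ t ≤ ENNReal.ofReal y then 1 else 0
  | .up, .user, .HD =>
      if ENNReal.ofReal (N.ratio k t) * N.δ γ t ≤ ENNReal.ofReal y then 1 else 0

/-- Intensity measure of the interfering nodes of kind `n`, tier `t` and mode `m`, with the
receiver at the origin, given that the transmit distance is `r`. -/
def intensity {N : Params} (S : BaseStations N) (γ : Fin 2 → ℝ≥0∞) (d : Link) (k t : Fin 2)
    (n : Node) (m : Mode) (r : ℝ) : Measure Plane :=
  volume.withDensity fun x =>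
    allowedFraction N γ d k t r ‖x‖ n m * intensityFn S γ d k t r ‖x‖ n m

/-! ### Interference and SINR -/

/-- The reception on a link (`d = down`: at the typical user, `d = up`: at the tagged base station)
for a typical user of tier `k`, the receiver being at the origin. `law r` is the conditional law
given that the transmit distance is `r`. Under it the locations of the interfering nodes of each
tier, kind and mode form independent Poisson processes with the intensities above, and the fading
coefficients (`h₀` of the useful signal, `h t n m i` of the `i`-th interferer) are independent of
the locations and i.i.d. exponential with mean `1`. -/
structure Reception {N : Params} (S : BaseStations N) (γ : Fin 2 → ℝ≥0∞) (d : Link)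
    (k : Fin 2) where
  Ω : Type*
  [mΩ : MeasurableSpace Ω]
  law : Kernel ℝ Ω
  [markov : IsMarkovKernel law]
  Φ : Fin 2 → Node → Mode → PointProcess Ω Plane
  h₀ : Ω → ℝ
  h : Fin 2 → Node → Mode → ℕ → Ω → ℝ
  measurable_h₀ : Measurable h₀
  measurable_h : ∀ t n m i, Measurable (h t n m i)
  poisson : ∀ r, 0 < r → ∀ t n m, (Φ t n m).IsPoisson (law r) (intensity S γ d k t n m r)
  indep_locations : ∀ r, 0 < r →
    iIndepFun (fun s : Fin 2 × Node × Mode => (Φ s.1 s.2.1 s.2.2).config) (law r)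
  exp_h₀ : ∀ r, 0 < r → (law r).map h₀ = expMeasure 1
  exp_h : ∀ r, 0 < r → ∀ t n m i, (law r).map (h t n m i) = expMeasure 1
  /-- `none` stands for the useful signal. -/
  indep_fading : ∀ r, 0 < r →
    iIndepFun (fun s : Option (Fin 2 × Node × Mode × ℕ) =>
      s.elim h₀ fun q => h q.1 q.2.1 q.2.2.1 q.2.2.2) (law r)
  indep_fading_locations : ∀ r, 0 < r →
    IndepFun (fun ω => (h₀ ω, fun (q : Fin 2 × Node × Mode × ℕ) => h q.1 q.2.1 q.2.2.1 q.2.2.2 ω))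
      (fun ω => fun s : Fin 2 × Node × Mode => (Φ s.1 s.2.1 s.2.2).config ω) (law r)

attribute [instance] Reception.mΩ Reception.markov

namespace Reception

variable {N : Params} {S : BaseStations N} {γ : Fin 2 → ℝ≥0∞} {d : Link} {k : Fin 2}
  (M : Reception S γ d k)

/-- Power received from all interfering nodes of tier `t`, kind `n` and mode `m`. -/
def power (t : Fin 2) (n : Node) (m : Mode) (ω : M.Ω) : ℝ≥0∞ :=
  ∑' i : ℕ, if (i : ℕ∞) < (M.Φ t n m).num ω then
    ENNReal.ofReal (N.nodePower t n * M.h t n m i ω * ‖(M.Φ t n m).pt i ω‖ ^ (-N.α)) else 0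

/-- The cumulative interference from tier `t`. Full-duplex nodes transmit on both channels,
half-duplex base stations on channel 1 only and half-duplex users on channel 2 only. -/
def interference (t : Fin 2) (ω : M.Ω) : Channel → ℝ≥0∞
  | .ch1 => M.power t .bs .FD ω + M.power t .user .FD ω + M.power t .bs .HD ω
  | .ch2 => M.power t .bs .FD ω + M.power t .user .FD ω + M.power t .user .HD ω

/-- The SINR on channel `c` of a typical user in mode `m` at distance `r` from its tagged base
station. -/
def sinr (m : Mode) (c : Channel) (r : ℝ) (ω : M.Ω) : ℝ≥0∞ :=
  ENNReal.ofReal (N.signalPower k d * M.h₀ ω * r ^ (-N.α)) /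
    (ENNReal.ofReal (N.selfInterference k d m) + ∑ t, M.interference t ω c +
      ENNReal.ofReal N.noise)

/-- `ℙ(θ > T)` for the SINR `θ` on channel `c` of a typical user of tier `k` in mode `m`. -/
def tierCoverage (m : Mode) (c : Channel) (T : ℝ≥0) : ℝ :=
  (S.distLaw γ k m ⊗ₘ M.law).real {q : ℝ × M.Ω | (T : ℝ≥0∞) < M.sinr m c q.1 q.2}

end Reception

/-- The SINR coverage on channel `c` of a typical user in mode `m`, averaged over the tiers. -/
def coverage {N : Params} {S : BaseStations N} {γ : Fin 2 → ℝ≥0∞} {d : Link}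
    (M : ∀ k, Reception S γ d k) (m : Mode) (c : Channel) (T : ℝ≥0) : ℝ :=
  (∑ k, S.assocProb γ k m * (M k).tierCoverage m c T) / ∑ k, S.assocProb γ k m

/-- A hybrid-duplex network with received power thresholds `γ`: downlink and uplink reception for a
typical user of either tier. -/
abbrev Receptions {N : Params} (S : BaseStations N) (γ : Fin 2 → ℝ≥0∞) :=
  ∀ (d : Link) (k : Fin 2), Reception S γ d k

/-- `C^{i,FD,D}(T)`. -/
def coverageFDDown {N : Params} {S : BaseStations N} {γ : Fin 2 → ℝ≥0∞}
    (M : Receptions S γ) (c : Channel) (T : ℝ≥0) : ℝ :=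
  coverage (M .down) .FD c T

/-- `C^{i,FD,U}(T)`. -/
def coverageFDUp {N : Params} {S : BaseStations N} {γ : Fin 2 → ℝ≥0∞}
    (M : Receptions S γ) (c : Channel) (T : ℝ≥0) : ℝ :=
  coverage (M .up) .FD c T

/-- `C^{i,HD}(T)`: half-duplex users receive on channel 1 and transmit on channel 2. -/
def coverageHD {N : Params} {S : BaseStations N} {γ : Fin 2 → ℝ≥0∞}
    (M : Receptions S γ) (c : Channel) (T : ℝ≥0) : ℝ :=
  match c with
  | .ch1 => coverage (M .down) .HD .ch1 T
  | .ch2 => coverage (M .up) .HD .ch2 T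

end

end HetNet

/-! With thresholds `∞` almost every user is half-duplex, with thresholds `0` every user is
full-duplex. Since the nearest base station is almost surely at positive distance, the association
events of the two networks agree up to null sets. Hence so do the association probabilities and the
laws of the transmit distance, and the half-duplex densities of the first network are the
full-duplex densities of the second. It remains to compare success probabilities at a fixed distance
`r > 0`.

In the half-duplex network only one class of nodes interferes on each channel: base stations on
channel 1, users on channel 2. In the full-duplex network both classes interfere on both channels,
and there is self-interference. Discarding the latter and keeping only the matching class can only
raise the SINR. What is left is `partialSinr`, and the kept class has the same intensity measure in
both networks (`intensity_bs_HD_top`, `intensity_user_up_HD_top`).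

The two networks live on different sample spaces, so equality must come from laws. Integrating out
the exponential fading expresses the success probability through Laplace functionals of the
interferers (`law_lt_partialSinr`). These are determined by the intensity measure
(`IsPoisson.laplace_eq`), so no explicit formula is needed. -/

namespace HetNet

noncomputable section

/-! ### The decreasing exponential on `[0, ∞]` -/

/-- `exp (-x)`, equal to `0` at `x = ∞`. -/
def expNeg (x : ℝ≥0∞) : ℝ≥0∞ := (EReal.exp x)⁻¹

lemma one_le_exp_coe (x : ℝ≥0∞) : 1 ≤ EReal.exp x := by
  simpa using EReal.coe_ennreal_nonneg x

@[simp] lemma expNeg_zero : expNeg 0 = 1 := by simp [expNeg]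

lemma expNeg_le_one (x : ℝ≥0∞) : expNeg x ≤ 1 := by
  simpa [expNeg] using EReal.coe_ennreal_nonneg x

lemma expNeg_add (x y : ℝ≥0∞) : expNeg (x + y) = expNeg x * expNeg y := by
  have h (z : ℝ≥0∞) : EReal.exp z ≠ 0 := (one_pos.trans_le (one_le_exp_coe z)).ne'
  simp only [expNeg, EReal.coe_ennreal_add, EReal.exp_add]
  exact ENNReal.mul_inv (Or.inl (h x)) (Or.inr (h y))

lemma expNeg_sum {ι : Type*} (s : Finset ι) (f : ι → ℝ≥0∞) :
    expNeg (∑ i ∈ s, f i) = ∏ i ∈ s, expNeg (f i) := by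
  classical
  induction s using Finset.induction_on with
  | empty => simp
  | insert a s ha ih => rw [Finset.sum_insert ha, Finset.prod_insert ha, expNeg_add, ih]

lemma continuous_expNeg : Continuous expNeg :=
  continuous_inv.comp (ENNReal.continuous_exp.comp continuous_coe_ennreal_ereal)

lemma measurable_expNeg : Measurable expNeg := continuous_expNeg.measurable

lemma expNeg_ofReal {x : ℝ} (hx : 0 ≤ x) :
    expNeg (ENNReal.ofReal x) = ENNReal.ofReal (Real.exp (-x)) := by
  rw [expNeg, EReal.coe_ennreal_ofReal, max_eq_left hx, EReal.exp_coe, Real.exp_neg,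
    ENNReal.ofReal_inv_of_pos (Real.exp_pos x)]

@[simp] lemma expNeg_top : expNeg ∞ = 0 := by simp [expNeg]

/-- The inverse of `expNeg` on `[0, 1]`. -/
def negLog (y : ℝ≥0∞) : ℝ≥0∞ := (ENNReal.log y⁻¹).toENNReal

lemma expNeg_negLog {y : ℝ≥0∞} (hy : y ≤ 1) : expNeg (negLog y) = y := by
  rw [expNeg, negLog, EReal.coe_toENNReal, ENNReal.exp_log, inv_inv]
  rwa [ENNReal.zero_le_log_iff, ENNReal.one_le_inv]

lemma measurable_negLog : Measurable negLog :=
  (ENNReal.measurable_log.comp measurable_inv).ereal_toENNReal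

/-! ### Exponential random variables -/

lemma expMeasure_lt_ofReal (y : ℝ≥0∞) :
    expMeasure 1 {x | y < ENNReal.ofReal x} = expNeg y := by
  have : IsProbabilityMeasure (expMeasure 1) := isProbabilityMeasure_expMeasure one_pos
  induction y using ENNReal.recTopCoe with
  | top => simp
  | coe b =>
    have hs : {x : ℝ | (b : ℝ≥0∞) < ENNReal.ofReal x} = (Set.Iic (b : ℝ))ᶜ := by
      ext x
      rw [Set.mem_ofPred_eq, ← ENNReal.ofReal_coe_nnreal,
        ENNReal.ofReal_lt_ofReal_iff_of_nonneg b.coe_nonneg]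
      simp
    rw [hs, prob_compl_eq_one_sub measurableSet_Iic, ← ofReal_cdf, cdf_expMeasure_eq one_pos,
      if_pos b.coe_nonneg, ← ENNReal.ofReal_coe_nnreal, expNeg_ofReal b.coe_nonneg, ← ENNReal.ofReal_one,
      ← ENNReal.ofReal_sub]
    · simp
    · simp

/-- `-log E (exp (-p h))` for an exponential random variable `h` with mean `1`. -/
def fadingExponent (p : ℝ≥0∞) : ℝ≥0∞ :=
  negLog (∫⁻ x, expNeg (p * ENNReal.ofReal x) ∂expMeasure 1)

lemma expNeg_fadingExponent (p : ℝ≥0∞) :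
    expNeg (fadingExponent p) = ∫⁻ x, expNeg (p * ENNReal.ofReal x) ∂expMeasure 1 := by
  have : IsProbabilityMeasure (expMeasure 1) := isProbabilityMeasure_expMeasure one_pos
  refine expNeg_negLog ((lintegral_mono fun x => expNeg_le_one _).trans ?_)
  simp

lemma measurable_fadingExponent : Measurable fadingExponent := by
  have : IsProbabilityMeasure (expMeasure 1) := isProbabilityMeasure_expMeasure one_pos
  refine measurable_negLog.comp (Measurable.lintegral_prod_right' (f := fun q : ℝ≥0∞ × ℝ =>
    expNeg (q.1 * ENNReal.ofReal q.2)) (measurable_expNeg.comp ?_))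
  fun_prop

-- Lets indices beyond the number of points be padded with weight `0` without affecting the
-- exponent.
@[simp] lemma fadingExponent_zero : fadingExponent 0 = 0 := by
  have : IsProbabilityMeasure (expMeasure 1) := isProbabilityMeasure_expMeasure one_pos
  simp [fadingExponent, negLog]

section Fading

variable {Ω : Type*} [MeasurableSpace Ω] {μ : Measure Ω} [IsProbabilityMeasure μ]
  {ι : Type*} [Countable ι]

/-- For finite partial sums this is independence; dominated convergence, with bound `1`, passes to
the whole series, which may diverge to `∞`. -/
lemma lintegral_expNeg_tsum {h : ι → Ω → ℝ} (hm : ∀ i, Measurable (h i)) (hind : iIndepFun h μ)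
    (hexp : ∀ i, μ.map (h i) = expMeasure 1) (p : ι → ℝ≥0∞) :
    ∫⁻ ω, expNeg (∑' i, p i * ENNReal.ofReal (h i ω)) ∂μ = expNeg (∑' i, fadingExponent (p i)) := by
  have hmeas (i : ι) : Measurable fun x : ℝ => expNeg (p i * ENNReal.ofReal x) :=
    measurable_expNeg.comp (by fun_prop)
  have hlim : Filter.Tendsto
      (fun s : Finset ι => ∫⁻ ω, expNeg (∑ i ∈ s, p i * ENNReal.ofReal (h i ω)) ∂μ)
      Filter.atTop (nhds (∫⁻ ω, expNeg (∑' i, p i * ENNReal.ofReal (h i ω)) ∂μ)) := by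
    refine tendsto_lintegral_filter_of_dominated_convergence (fun _ => 1)
      (Filter.Eventually.of_forall fun s => ?_)
      (Filter.Eventually.of_forall fun s => ae_of_all _ fun ω => expNeg_le_one _) (by simp)
      (ae_of_all _ fun ω => ?_)
    · exact measurable_expNeg.comp (by fun_prop)
    · exact (continuous_expNeg.tendsto _).comp ENNReal.summable.hasSum
  refine tendsto_nhds_unique hlim ?_
  have heq (s : Finset ι) : ∫⁻ ω, expNeg (∑ i ∈ s, p i * ENNReal.ofReal (h i ω)) ∂μ
      = expNeg (∑ i ∈ s, fadingExponent (p i)) := by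
    have h1 : iIndepFun (fun i ω => expNeg (p i * ENNReal.ofReal (h i ω))) μ :=
      hind.comp (fun i x => expNeg (p i * ENNReal.ofReal x)) hmeas
    simp_rw [expNeg_sum]
    rw [lintegral_prod_eq_prod_lintegral_of_indepFun s _ h1 fun i => (hmeas i).comp (hm i)]
    refine Finset.prod_congr rfl fun i _ => ?_
    rw [expNeg_fadingExponent, ← hexp i, lintegral_map (hmeas i) (hm i)]
  simp_rw [heq]
  exact (continuous_expNeg.tendsto _).comp ENNReal.summable.hasSum

/-- Given the other variables, the exponential tail of `h none` turns the probability into `expNeg`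
of the threshold, whose mean factors by independence. -/
lemma measure_add_tsum_lt_exponential {h : Option ι → Ω → ℝ} (hm : ∀ i, Measurable (h i))
    (hind : iIndepFun h μ) (hexp : ∀ i, μ.map (h i) = expMeasure 1) (b : ℝ≥0∞) (p : ι → ℝ≥0∞) :
    μ {ω | b + ∑' i, p i * ENNReal.ofReal (h (some i) ω) < ENNReal.ofReal (h none ω)}
      = expNeg (b + ∑' i, fadingExponent (p i)) := by
  -- Independence from the whole family is checked on its finite subfamilies.
  have hI : IndepFun (h none) (fun ω i => h (some i) ω) μ := by
    refine IndepFun.indepFun_process (hm none) (fun i => hm _) fun I => ?_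
    have := hind.indepFun_finset {none} (I.map Function.Embedding.some) (by simp) hm
    let φ : (({none} : Finset (Option ι)) → ℝ) → ℝ := fun f => f ⟨none, by simp⟩
    let ψ : (I.map Function.Embedding.some → ℝ) → I → ℝ := fun f i => f ⟨some i, by simp⟩
    have hφ : Measurable φ := measurable_pi_apply _
    have hψ : Measurable ψ := measurable_pi_lambda _ fun i => measurable_pi_apply _
    exact this.comp hφ hψ
  have hmap := (indepFun_iff_map_prod_eq_prod_map_map (hm none).aemeasurable
    (measurable_pi_lambda _ fun i => hm (some i)).aemeasurable).1 hI
  have hms : Measurable fun ω i => h (some i) ω := measurable_pi_lambda _ fun i => hm (some i)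
  have : IsProbabilityMeasure (expMeasure 1) := isProbabilityMeasure_expMeasure one_pos
  have : IsProbabilityMeasure (μ.map fun ω i => h (some i) ω) :=
    Measure.isProbabilityMeasure_map hms.aemeasurable
  have hA : MeasurableSet {q : ℝ × (ι → ℝ) |
      b + ∑' i, p i * ENNReal.ofReal (q.2 i) < ENNReal.ofReal q.1} := by
    refine measurableSet_lt (measurable_const.add (Measurable.tsum fun i => ?_)) ?_
    all_goals fun_prop
  have key : μ {ω | b + ∑' i, p i * ENNReal.ofReal (h (some i) ω) < ENNReal.ofReal (h none ω)}
      = (μ.map fun ω => (h none ω, fun i => h (some i) ω)) {q : ℝ × (ι → ℝ) |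
        b + ∑' i, p i * ENNReal.ofReal (q.2 i) < ENNReal.ofReal q.1} := by
    rw [Measure.map_apply ((hm none).prodMk hms) hA]
    rfl
  have hmf : Measurable fun f : ι → ℝ => expNeg (b + ∑' i, p i * ENNReal.ofReal (f i)) := by
    refine measurable_expNeg.comp (measurable_const.add (Measurable.tsum fun i => ?_))
    fun_prop
  rw [key, hmap, hexp, Measure.prod_apply_symm hA]
  simp only [Set.preimage_ofPred_eq, expMeasure_lt_ofReal]
  rw [lintegral_map hmf hms]
  simp_rw [expNeg_add]
  rw [lintegral_const_mul, lintegral_expNeg_tsum (fun i => hm (some i))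
    (hind.precomp (Option.some_injective ι)) (fun i => hexp (some i))]
  exact measurable_expNeg.comp (Measurable.tsum fun i => by fun_prop)

/-- Conditioning one of two independent random elements on the other. -/
lemma measure_eq_lintegral_of_indepFun {α β : Type*} [MeasurableSpace α]
    [MeasurableSpace β]
    {X : Ω → α} {Y : Ω → β} (hX : Measurable X) (hY : Measurable Y) (hind : IndepFun X Y μ)
    {A : Set (α × β)} (hA : MeasurableSet A) :
    μ {ω | (X ω, Y ω) ∈ A} = ∫⁻ ω', μ {ω | (X ω, Y ω') ∈ A} ∂μ := by
  have hmap := (indepFun_iff_map_prod_eq_prod_map_map hX.aemeasurable hY.aemeasurable).1 hind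
  have h1 : μ {ω | (X ω, Y ω) ∈ A} = (μ.map fun ω => (X ω, Y ω)) A :=
    (Measure.map_apply (hX.prodMk hY) hA).symm
  rw [h1, hmap, Measure.prod_apply_symm hA, lintegral_map (measurable_measure_prodMk_right hA) hY]
  refine lintegral_congr fun ω' => ?_
  rw [Measure.map_apply hX (measurable_prodMk_right hA)]
  rfl

end Fading

/-! ### Laplace functionals of Poisson processes -/

namespace PointProcess

section

variable {Ω E : Type*} [MeasurableSpace Ω] [MeasurableSpace E]

/-- The counting measure of the points of the process. -/
def toMeasure (Φ : PointProcess Ω E) (ω : Ω) : Measure E :=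
  Measure.sum fun i : ℕ => if (i : ℕ∞) < Φ.num ω then Measure.dirac (Φ.pt i ω) else 0

lemma lintegral_toMeasure (Φ : PointProcess Ω E) (ω : Ω) {f : E → ℝ≥0∞} (hf : Measurable f) :
    ∫⁻ x, f x ∂Φ.toMeasure ω = ∑' i : ℕ, if (i : ℕ∞) < Φ.num ω then f (Φ.pt i ω) else 0 := by
  rw [toMeasure, lintegral_sum_measure]
  refine tsum_congr fun i => ?_
  split_ifs <;> simp [lintegral_dirac' _ hf]

lemma toMeasure_apply (Φ : PointProcess Ω E) (ω : Ω) {B : Set E} (hB : MeasurableSet B) :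
    Φ.toMeasure ω B = (Φ.count B ω : ℝ≥0∞) := by
  rw [← lintegral_indicator_one hB, lintegral_toMeasure _ _ (measurable_one.indicator hB), count,
    ← ENNReal.tsum_set_one, tsum_subtype _ fun _ => (1 : ℝ≥0∞)]
  refine tsum_congr fun i => ?_
  by_cases h1 : (i : ℕ∞) < Φ.num ω <;> by_cases h2 : Φ.pt i ω ∈ B <;> simp [h1, h2]

lemma measurableSet_lt_num (Φ : PointProcess Ω E) (i : ℕ) :
    MeasurableSet {ω | (i : ℕ∞) < Φ.num ω} :=
  Φ.measurable_num (MeasurableSet.of_discrete (s := Set.Ioi (i : ℕ∞)))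

lemma measurable_lintegral (Φ : PointProcess Ω E) {f : E → ℝ≥0∞} (hf : Measurable f) :
    Measurable fun ω => ∫⁻ x, f x ∂Φ.toMeasure ω := by
  simp_rw [Φ.lintegral_toMeasure _ hf]
  exact Measurable.tsum fun i =>
    Measurable.ite (Φ.measurableSet_lt_num i) (hf.comp (Φ.measurable_pt i)) measurable_const

lemma measurable_count (Φ : PointProcess Ω E) {B : Set E} (hB : MeasurableSet B) :
    Measurable (Φ.count B) := by
  have h1 : Measurable fun ω => (Φ.count B ω : ℝ≥0∞) := by
    have := Φ.measurable_lintegral (measurable_one.indicator hB)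
    simpa only [lintegral_indicator_one hB, Φ.toMeasure_apply _ hB] using this
  refine measurable_to_countable' fun n => ?_
  have : Φ.count B ⁻¹' {n} = (fun ω => (Φ.count B ω : ℝ≥0∞)) ⁻¹' {(n : ℝ≥0∞)} := by
    ext ω
    simp
  rw [this]
  exact h1 (measurableSet_singleton _)

lemma measurable_config (Φ : PointProcess Ω E) : Measurable Φ.config :=
  Φ.measurable_num.prodMk (measurable_pi_lambda _ Φ.measurable_pt)

end

variable {Ω Ω' E : Type*} [MeasurableSpace Ω] [MeasurableSpace Ω'] [MeasurableSpace E]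
  {μ : Measure Ω} {μ' : Measure Ω'} {Λ : Measure E} {Φ : PointProcess Ω E}
  {Ψ : PointProcess Ω' E}

lemma IsPoisson.measure_count_eq_zero (hΦ : Φ.IsPoisson μ Λ) {B : Set E} (hB : MeasurableSet B)
    (hΛ : Λ B ≠ ∞) : μ {ω | Φ.count B ω = 0} = expNeg (Λ B) := by
  have := hΦ.1 B hB hΛ 0
  rw [Nat.cast_zero] at this
  have hΛ' : expNeg (Λ B) = ENNReal.ofReal (Real.exp (-(Λ B).toReal)) := by
    rw [← expNeg_ofReal ENNReal.toReal_nonneg, ENNReal.ofReal_toReal hΛ]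
  rw [this, hΛ', poissonMeasure_singleton]
  simp [ENNReal.coe_toNNReal_eq_toReal]

/-- The integral of `g` against the points is a weighted sum of the counts in the fibres of `g`; the
fibres are disjoint, so the counts are independent. -/
lemma IsPoisson.lintegral_expNeg_simpleFunc (hΦ : Φ.IsPoisson μ Λ) (g : SimpleFunc E ℝ≥0∞) :
    ∫⁻ ω, expNeg (∫⁻ x, g x ∂Φ.toMeasure ω) ∂μ
      = ∏ c ∈ g.range, ∫⁻ n, expNeg (c * (n : ℝ≥0∞)) ∂(μ.map (Φ.count (g ⁻¹' {c}))) := by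
  let e := g.range.equivFin
  have hmeas (i) : MeasurableSet (g ⁻¹' {(e.symm i : ℝ≥0∞)}) := g.measurableSet_fiber _
  have hind := (hΦ.2 _ (fun i => g ⁻¹' {(e.symm i : ℝ≥0∞)}) hmeas fun i j hij =>
    Set.disjoint_left.2 fun x hx hy => hij <| e.symm.injective <| Subtype.ext <| by
      rw [← (show g x = _ from hx), ← (show g x = _ from hy)]).comp
        (fun i n => expNeg ((e.symm i : ℝ≥0∞) * (n : ℝ≥0∞))) fun i => Measurable.of_discrete
  have hprod (f : ℝ≥0∞ → ℝ≥0∞) : ∏ c ∈ g.range, f c = ∏ i, f (e.symm i) := by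
    rw [← Finset.prod_coe_sort, ← e.symm.prod_comp]
  have h1 (ω : Ω) : expNeg (∫⁻ x, g x ∂Φ.toMeasure ω)
      = ∏ i, expNeg ((e.symm i : ℝ≥0∞) * (Φ.count (g ⁻¹' {(e.symm i : ℝ≥0∞)}) ω : ℝ≥0∞)) := by
    rw [SimpleFunc.lintegral_eq_lintegral, SimpleFunc.lintegral, expNeg_sum, hprod]
    simp_rw [Φ.toMeasure_apply _ (g.measurableSet_fiber _)]
  have h2 := lintegral_prod_eq_prod_lintegral_of_indepFun Finset.univ _ hind fun i =>
    Measurable.of_discrete.comp (Φ.measurable_count (hmeas i))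
  simp_rw [h1]
  rw [hprod]
  refine h2.trans ?_
  refine Finset.prod_congr rfl fun i _ => ?_
  rw [lintegral_map Measurable.of_discrete (Φ.measurable_count (hmeas i))]
  rfl

variable [IsProbabilityMeasure μ] [IsProbabilityMeasure μ']

lemma IsPoisson.ae_num_eq_zero (hΦ : Φ.IsPoisson μ 0) :
    ∀ᵐ ω ∂μ, ∀ i : ℕ, ¬ (i : ℕ∞) < Φ.num ω := by
  have h := hΦ.measure_count_eq_zero MeasurableSet.univ (by simp)
  have h0 : MeasurableSet {ω | Φ.count Set.univ ω = 0} :=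
    Φ.measurable_count MeasurableSet.univ (measurableSet_singleton 0)
  rw [Measure.coe_zero, Pi.zero_apply, expNeg_zero, ← mem_ae_iff_prob_eq_one h0] at h
  filter_upwards [h] with ω hω i hi
  have : Set.encard {i : ℕ | (i : ℕ∞) < Φ.num ω ∧ Φ.pt i ω ∈ Set.univ} = 0 := hω
  rw [Set.encard_eq_zero] at this
  exact Set.eq_empty_iff_forall_notMem.1 this i ⟨hi, trivial⟩

lemma IsPoisson.map_count_eq (hΦ : Φ.IsPoisson μ Λ) (hΨ : Ψ.IsPoisson μ' Λ) {B : Set E}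
    (hB : MeasurableSet B) (hΛ : Λ B ≠ ∞) : μ.map (Φ.count B) = μ'.map (Ψ.count B) := by
  have hn (n : ℕ) : μ.map (Φ.count B) {(n : ℕ∞)} = μ'.map (Ψ.count B) {(n : ℕ∞)} := by
    rw [Measure.map_apply (Φ.measurable_count hB) (measurableSet_singleton _),
      Measure.map_apply (Ψ.measurable_count hB) (measurableSet_singleton _)]
    exact (hΦ.1 B hB hΛ n).trans (hΨ.1 B hB hΛ n).symm
  have : IsProbabilityMeasure (μ.map (Φ.count B)) :=
    Measure.isProbabilityMeasure_map (Φ.measurable_count hB).aemeasurable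
  have : IsProbabilityMeasure (μ'.map (Ψ.count B)) :=
    Measure.isProbabilityMeasure_map (Ψ.measurable_count hB).aemeasurable
  -- The Poisson law prescribes the masses of the finite values only; the mass at `⊤` is the
  -- complement of their sum.
  refine Measure.ext_iff_singleton.2 fun n => ?_
  induction n using ENat.recTopCoe with
  | coe n => exact hn n
  | top =>
    have htop : ({⊤} : Set ℕ∞) = (⋃ n : ℕ, {(n : ℕ∞)})ᶜ := by
      ext n
      induction n using ENat.recTopCoe <;> simp
    have hdis : Pairwise (Function.onFun Disjoint fun n : ℕ => ({(n : ℕ∞)} : Set ℕ∞)) :=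
      fun i j hij => by simpa using hij
    rw [htop, prob_compl_eq_one_sub MeasurableSet.of_discrete,
      prob_compl_eq_one_sub MeasurableSet.of_discrete,
      measure_iUnion hdis fun _ => measurableSet_singleton _,
      measure_iUnion hdis fun _ => measurableSet_singleton _]
    simp_rw [hn]

lemma tendsto_lintegral_expNeg_toMeasure (Φ : PointProcess Ω E) {g : ℕ → SimpleFunc E ℝ≥0∞}
    {f : E → ℝ≥0∞} (hmono : Monotone fun n x => g n x) (hsup : ∀ x, ⨆ n, g n x = f x) :
    Filter.Tendsto (fun n => ∫⁻ ω, expNeg (∫⁻ x, g n x ∂Φ.toMeasure ω) ∂μ) Filter.atTop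
      (nhds (∫⁻ ω, expNeg (∫⁻ x, f x ∂Φ.toMeasure ω) ∂μ)) := by
  refine tendsto_lintegral_of_dominated_convergence (fun _ => 1)
    (fun n => measurable_expNeg.comp (Φ.measurable_lintegral (g n).measurable))
    (fun n => ae_of_all _ fun ω => expNeg_le_one _) (by simp) (ae_of_all _ fun ω => ?_)
  refine (continuous_expNeg.tendsto _).comp ?_
  have h1 : ∫⁻ x, f x ∂Φ.toMeasure ω = ⨆ n, ∫⁻ x, g n x ∂Φ.toMeasure ω := by
    rw [← lintegral_iSup (fun n => (g n).measurable) hmono]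
    simp_rw [hsup]
  rw [h1]
  exact tendsto_atTop_iSup fun m n hmn => lintegral_mono (hmono hmn)

/-- The Laplace functional of a Poisson process only depends on its intensity measure. -/
lemma IsPoisson.laplace_eq [SigmaFinite Λ] (hΦ : Φ.IsPoisson μ Λ) (hΨ : Ψ.IsPoisson μ' Λ)
    {f : E → ℝ≥0∞} (hf : Measurable f) :
    ∫⁻ ω, expNeg (∫⁻ x, f x ∂Φ.toMeasure ω) ∂μ = ∫⁻ ω, expNeg (∫⁻ x, f x ∂Ψ.toMeasure ω) ∂μ' := by
  -- The law of a count is known only on sets of finite intensity, so the approximations of `f` are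
  -- cut off to the spanning sets.
  let g (n : ℕ) : SimpleFunc E ℝ≥0∞ := (SimpleFunc.eapprox f n).restrict (spanningSets Λ n)
  have hg (n : ℕ) (x : E) :
      g n x = (spanningSets Λ n).indicator (SimpleFunc.eapprox f n) x :=
    SimpleFunc.restrict_apply _ (measurableSet_spanningSets Λ n) x
  have hmono : Monotone fun n x => g n x := by
    intro m n hmn x
    simp only [hg]
    refine (Set.indicator_le_indicator_of_subset (monotone_spanningSets Λ hmn)
      (fun _ => zero_le) x).trans (Set.indicator_le_indicator ?_)
    exact SimpleFunc.monotone_eapprox f hmn x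
  have hsup (x : E) : ⨆ n, g n x = f x := by
    rw [← SimpleFunc.iSup_eapprox_apply hf x]
    refine le_antisymm (iSup_mono fun n => ?_) (iSup_le fun n => ?_)
    · rw [hg]
      exact Set.indicator_le_self' (fun _ _ => zero_le) x
    · obtain ⟨N, hN⟩ := Set.mem_iUnion.1 ((iUnion_spanningSets Λ).symm ▸ Set.mem_univ x)
      refine le_iSup_of_le (max n N) ?_
      rw [hg, Set.indicator_of_mem (monotone_spanningSets Λ (le_max_right _ _) hN)]
      exact SimpleFunc.monotone_eapprox f (le_max_left _ _) x
  refine tendsto_nhds_unique (tendsto_lintegral_expNeg_toMeasure Φ hmono hsup)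
    ((tendsto_lintegral_expNeg_toMeasure Ψ hmono hsup).congr fun n => ?_)
  rw [hΦ.lintegral_expNeg_simpleFunc, hΨ.lintegral_expNeg_simpleFunc]
  refine Finset.prod_congr rfl fun c _ => ?_
  -- The fibre over `0` may have infinite intensity, but its factor is `1` whatever the count; every
  -- other fibre lies in a spanning set.
  by_cases hc : c = 0
  · have : IsProbabilityMeasure (μ.map (Φ.count (g n ⁻¹' {c}))) :=
      Measure.isProbabilityMeasure_map
        (Φ.measurable_count ((g n).measurableSet_fiber c)).aemeasurable
    have : IsProbabilityMeasure (μ'.map (Ψ.count (g n ⁻¹' {c}))) :=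
      Measure.isProbabilityMeasure_map
        (Ψ.measurable_count ((g n).measurableSet_fiber c)).aemeasurable
    have h0 (n : ℕ∞) : expNeg (c * (n : ℝ≥0∞)) = 1 := by simp [hc]
    simp [h0]
  · rw [hΦ.map_count_eq hΨ ((g n).measurableSet_fiber c)]
    refine ((measure_mono fun x hx => ?_).trans_lt (measure_spanningSets_lt_top Λ n)).ne
    by_contra hx'
    have : g n x = c := hx
    rw [hg, Set.indicator_of_notMem hx'] at this
    exact hc this.symm

end PointProcess

/-! ### Success probability with one class of interferers -/

instance : Countable Node :=
  Function.Injective.countable (f := fun n : Node => match n with | .bs => true | .user => false)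
    (by rintro ⟨⟩ ⟨⟩ <;> simp)

instance : Countable Mode :=
  Function.Injective.countable (f := fun m : Mode => match m with | .FD => true | .HD => false)
    (by rintro ⟨⟩ ⟨⟩ <;> simp)

lemma measure_pos_eq_iSup {Ω : Type*} [MeasurableSpace Ω] (μ : Measure Ω) (f : Ω → ℝ≥0∞) :
    μ {ω | 0 < f ω} = ⨆ j : ℕ, μ {ω | (((j : ℝ≥0) + 1)⁻¹ : ℝ≥0) < f ω} := by
  rw [← Monotone.measure_iUnion]
  · congr 1
    ext ω
    simp only [Set.mem_ofPred_eq, Set.mem_iUnion]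
    refine ⟨fun h => ?_, fun ⟨j, hj⟩ => zero_le.trans_lt hj⟩
    obtain ⟨j, hj⟩ := ENNReal.exists_inv_nat_lt h.ne'
    refine ⟨j, lt_of_le_of_lt ?_ hj⟩
    rw [ENNReal.coe_inv (by positivity)]
    exact ENNReal.inv_le_inv.2 (by push_cast; exact le_self_add)
  · intro i j hij
    refine Set.ofPred_subset_ofPred.2 fun ω hω => lt_of_le_of_lt ?_ hω
    rw [ENNReal.coe_le_coe]
    gcongr

lemma Params.signalPower_pos (N : Params) (k : Fin 2) (d : Link) : 0 < N.signalPower k d := by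
  cases d
  · exact N.P_pos k
  · exact N.PU_pos

/-- Power received without fading from a node at the given position. -/
def Params.pathPower (N : Params) (t : Fin 2) (n : Node) (x : Plane) : ℝ≥0∞ :=
  ENNReal.ofReal (N.nodePower t n * ‖x‖ ^ (-N.α))

lemma Params.measurable_pathPower (N : Params) (t : Fin 2) (n : Node) :
    Measurable (N.pathPower t n) := by
  unfold Params.pathPower
  fun_prop

lemma Params.nodePower_nonneg (N : Params) (t : Fin 2) (n : Node) : 0 ≤ N.nodePower t n := by
  cases n
  · exact (N.P_pos t).le
  · exact N.PU_pos.le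

namespace Reception

variable {N : Params} {S : BaseStations N} {γ : Fin 2 → ℝ≥0∞} {d : Link} {k : Fin 2}
  (M : Reception S γ d k)

lemma power_eq_tsum (t : Fin 2) (n : Node) (m : Mode) (ω : M.Ω) :
    M.power t n m ω = ∑' i : ℕ, (if (i : ℕ∞) < (M.Φ t n m).num ω then
      N.pathPower t n ((M.Φ t n m).pt i ω) else 0) * ENNReal.ofReal (M.h t n m i ω) := by
  refine tsum_congr fun i => ?_
  split_ifs
  · rw [Params.pathPower, ← ENNReal.ofReal_mul
      (mul_nonneg (N.nodePower_nonneg t n) (Real.rpow_nonneg (norm_nonneg _) _))]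
    ring_nf
  · simp

lemma measurable_power (t : Fin 2) (n : Node) (m : Mode) : Measurable (M.power t n m) := by
  simp_rw [funext (M.power_eq_tsum t n m)]
  exact Measurable.tsum fun i => (Measurable.ite ((M.Φ t n m).measurableSet_lt_num i)
    ((N.measurable_pathPower t n).comp ((M.Φ t n m).measurable_pt i)) measurable_const).mul
      (M.measurable_h t n m i).ennreal_ofReal

/-- The signal-to-interference-plus-noise ratio when only the nodes of one kind and mode interfere
and there is no self-interference. -/
def partialSinr (n : Node) (m : Mode) (r : ℝ) (ω : M.Ω) : ℝ≥0∞ :=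
  ENNReal.ofReal (N.signalPower k d * M.h₀ ω * r ^ (-N.α)) /
    (∑ t, M.power t n m ω + ENNReal.ofReal N.noise)

lemma lt_partialSinr_iff {n : Node} {m : Mode} {r : ℝ} (hr : 0 < r) {T : ℝ≥0∞} (hT : T ≠ 0)
    (hT' : T ≠ ∞) {c : ℝ≥0∞}
    (hc : c = T / ENNReal.ofReal (N.signalPower k d * r ^ (-N.α))) (ω : M.Ω) :
    T < M.partialSinr n m r ω ↔
      c * ENNReal.ofReal N.noise + c * ∑ t, M.power t n m ω < ENNReal.ofReal (M.h₀ ω) := by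
  have ha : 0 < N.signalPower k d * r ^ (-N.α) :=
    mul_pos (N.signalPower_pos k d) (Real.rpow_pos_of_pos hr _)
  have ha' : ENNReal.ofReal (N.signalPower k d * r ^ (-N.α)) ≠ 0 := by simpa using ha
  have hn : ENNReal.ofReal N.noise ≠ 0 := by simpa using N.noise_pos
  rw [partialSinr, ENNReal.lt_div_iff_mul_lt (Or.inr hT') (Or.inr hT) |>.trans Iff.rfl,
    mul_right_comm, ENNReal.ofReal_mul ha.le, ← mul_add, hc, add_comm (∑ t, _), mul_comm
      (ENNReal.ofReal (N.signalPower k d * r ^ (-N.α))),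
    ← ENNReal.div_lt_iff (Or.inl ha') (Or.inl ENNReal.ofReal_ne_top), ENNReal.mul_div_right_comm]

/-- The success probability only depends on the Laplace functionals of the interferers. -/
lemma law_lt_partialSinr {n : Node} {m : Mode} {r : ℝ} (hr : 0 < r) {T : ℝ≥0∞} (hT : T ≠ 0)
    (hT' : T ≠ ∞) {c : ℝ≥0∞}
    (hc : c = T / ENNReal.ofReal (N.signalPower k d * r ^ (-N.α))) :
    M.law r {ω | T < M.partialSinr n m r ω} = expNeg (c * ENNReal.ofReal N.noise) *
      ∏ t, ∫⁻ ω, expNeg (∫⁻ x, fadingExponent (c * N.pathPower t n x)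
        ∂(M.Φ t n m).toMeasure ω) ∂M.law r := by
  -- `X` collects the fading coefficients, `Y` the locations, and `w` the rescaled path powers. With
  -- `Y` frozen, the success event compares one exponential variable with a weighted sum of others.
  let X (ω : M.Ω) (s : Option (Fin 2 × ℕ)) : ℝ := s.elim (M.h₀ ω) fun q => M.h q.1 n m q.2 ω
  let Y (ω : M.Ω) (t : Fin 2) : ℕ∞ × (ℕ → Plane) := (M.Φ t n m).config ω
  let w (y : Fin 2 → ℕ∞ × (ℕ → Plane)) (j : Fin 2 × ℕ) : ℝ≥0∞ :=
    if (j.2 : ℕ∞) < (y j.1).1 then c * N.pathPower j.1 n ((y j.1).2 j.2) else 0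
  have hXm (s) : Measurable fun ω => X ω s := by
    cases s with
    | none => exact M.measurable_h₀
    | some q => exact M.measurable_h q.1 n m q.2
  have hX : Measurable X := measurable_pi_lambda _ hXm
  have hY : Measurable Y := measurable_pi_lambda _ fun t => (M.Φ t n m).measurable_config
  have hset (i : ℕ) : MeasurableSet {y : ℕ∞ × (ℕ → Plane) | (i : ℕ∞) < y.1} :=
    measurable_fst (MeasurableSet.of_discrete (s := Set.Ioi (i : ℕ∞)))
  have hw (j) : Measurable fun y => w y j := by
    refine Measurable.ite ?_ (measurable_const.mul ((N.measurable_pathPower j.1 n).comp ?_))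
      measurable_const
    · exact (measurable_pi_apply (X := fun _ : Fin 2 => ℕ∞ × (ℕ → Plane)) j.1) (hset j.2)
    · fun_prop
  have hind : IndepFun X Y (M.law r) := by
    have h := M.indep_fading_locations r hr
    let φ (q : ℝ × (Fin 2 × Node × Mode × ℕ → ℝ)) (s : Option (Fin 2 × ℕ)) : ℝ :=
      s.elim q.1 fun j => q.2 (j.1, n, m, j.2)
    let ψ (f : Fin 2 × Node × Mode → ℕ∞ × (ℕ → Plane)) (t : Fin 2) := f (t, n, m)
    have hφ : Measurable φ := by
      refine measurable_pi_lambda _ fun s => ?_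
      cases s with
      | none => exact measurable_fst
      | some j => exact (measurable_pi_apply _).comp measurable_snd
    have hψ : Measurable ψ := measurable_pi_lambda _ fun t => measurable_pi_apply _
    exact h.comp hφ hψ
  have hXind : iIndepFun (fun s ω => X ω s) (M.law r) := by
    have h := (M.indep_fading r hr).precomp
      (g := Option.map fun j : Fin 2 × ℕ => (j.1, n, m, j.2))
      (Option.map_injective fun i j hij => by simpa [Prod.ext_iff] using hij)
    refine (iIndepFun_congr fun s => ?_).1 h
    cases s <;> rfl
  have hXexp (s) : (M.law r).map (fun ω => X ω s) = expMeasure 1 := by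
    cases s with
    | none => exact M.exp_h₀ r hr
    | some q => exact M.exp_h r hr q.1 n m q.2
  let A : Set ((Option (Fin 2 × ℕ) → ℝ) × (Fin 2 → ℕ∞ × (ℕ → Plane))) :=
    {q | c * ENNReal.ofReal N.noise + ∑' j, w q.2 j * ENNReal.ofReal (q.1 (some j)) <
      ENNReal.ofReal (q.1 none)}
  have hA : MeasurableSet A := by
    refine measurableSet_lt (measurable_const.add (Measurable.tsum fun j => ?_)) (by fun_prop)
    exact ((hw j).comp measurable_snd).mul (by fun_prop)
  have hpow (ω : M.Ω) : c * ∑ t, M.power t n m ω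
      = ∑' j, w (Y ω) j * ENNReal.ofReal (X ω (some j)) := by
    rw [ENNReal.tsum_prod', tsum_fintype, Finset.mul_sum]
    refine Finset.sum_congr rfl fun t _ => ?_
    rw [power_eq_tsum, ← ENNReal.tsum_mul_left]
    refine tsum_congr fun i => ?_
    rw [← mul_assoc, mul_ite, mul_zero]
    rfl
  have hf (t : Fin 2) : Measurable fun x => fadingExponent (c * N.pathPower t n x) :=
    measurable_fadingExponent.comp (measurable_const.mul (N.measurable_pathPower t n))
  have hexpo (ω : M.Ω) : ∑' j, fadingExponent (w (Y ω) j) = ∑ t, ∫⁻ x,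
      fadingExponent (c * N.pathPower t n x) ∂(M.Φ t n m).toMeasure ω := by
    rw [ENNReal.tsum_prod', tsum_fintype]
    refine Finset.sum_congr rfl fun t _ => ?_
    rw [PointProcess.lintegral_toMeasure _ _ (hf t)]
    refine tsum_congr fun i => ?_
    rw [apply_ite fadingExponent, fadingExponent_zero]
    rfl
  -- Independence of the configurations of the two tiers makes the mean of the product split into
  -- one Laplace functional per tier.
  have hLind : iIndepFun (fun t ω => expNeg (∫⁻ x, fadingExponent (c * N.pathPower t n x)
      ∂(M.Φ t n m).toMeasure ω)) (M.law r) := by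
    have h := ((M.indep_locations r hr).precomp (g := fun t : Fin 2 => (t, n, m))
      fun i j hij => (Prod.ext_iff.1 hij).1).comp
      (fun t y => expNeg (∑' i : ℕ, if (i : ℕ∞) < y.1 then
        fadingExponent (c * N.pathPower t n (y.2 i)) else 0)) fun t =>
        measurable_expNeg.comp (Measurable.tsum fun i => Measurable.ite (hset i)
          ((hf t).comp (by fun_prop)) measurable_const)
    refine (iIndepFun_congr fun t => ?_).1 h
    refine ae_of_all _ fun ω => ?_
    beta_reduce
    rw [PointProcess.lintegral_toMeasure _ _ (hf t)]
    rfl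
  have hev : {ω | T < M.partialSinr n m r ω} = {ω | (X ω, Y ω) ∈ A} := by
    ext ω
    simp only [Set.mem_ofPred_eq, M.lt_partialSinr_iff hr hT hT' hc, hpow, A]
    rfl
  rw [hev, measure_eq_lintegral_of_indepFun hX hY hind hA]
  have hcond (ω' : M.Ω) : M.law r {ω | (X ω, Y ω') ∈ A} = expNeg (c * ENNReal.ofReal N.noise) *
      ∏ t, expNeg (∫⁻ x, fadingExponent (c * N.pathPower t n x) ∂(M.Φ t n m).toMeasure ω') := by
    rw [← expNeg_sum, ← hexpo, ← expNeg_add]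
    exact measure_add_tsum_lt_exponential hXm hXind hXexp (c * ENNReal.ofReal N.noise) (w (Y ω'))
  simp_rw [hcond]
  have hLm (t : Fin 2) : Measurable fun ω => expNeg (∫⁻ x, fadingExponent (c * N.pathPower t n x)
      ∂(M.Φ t n m).toMeasure ω) :=
    measurable_expNeg.comp ((M.Φ t n m).measurable_lintegral (hf t))
  rw [lintegral_const_mul _ (Finset.measurable_prod _ fun t _ => hLm t),
    lintegral_prod_eq_prod_lintegral_of_indepFun Finset.univ _ hLind hLm]

/-- Interferers with the same intensities lead to the same success probability. -/
lemma law_lt_partialSinr_congr {γ' : Fin 2 → ℝ≥0∞} (M' : Reception S γ' d k) {n : Node}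
    {m m' : Mode} {r : ℝ} (hr : 0 < r)
    (hfin : ∀ t, SigmaFinite (intensity S γ d k t n m r))
    (hint : ∀ t, intensity S γ d k t n m r = intensity S γ' d k t n m' r) (T : ℝ≥0) :
    M.law r {ω | (T : ℝ≥0∞) < M.partialSinr n m r ω}
      = M'.law r {ω | (T : ℝ≥0∞) < M'.partialSinr n m' r ω} := by
  have hpos {T : ℝ≥0} (hT : T ≠ 0) : M.law r {ω | (T : ℝ≥0∞) < M.partialSinr n m r ω}
      = M'.law r {ω | (T : ℝ≥0∞) < M'.partialSinr n m' r ω} := by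
    have hT0 : (T : ℝ≥0∞) ≠ 0 := by simpa using hT
    rw [M.law_lt_partialSinr hr hT0 ENNReal.coe_ne_top rfl,
      M'.law_lt_partialSinr hr hT0 ENNReal.coe_ne_top rfl]
    congr 1
    refine Finset.prod_congr rfl fun t _ => ?_
    exact (M.poisson r hr t n m).laplace_eq (hint t ▸ M'.poisson r hr t n m')
      (measurable_fadingExponent.comp (measurable_const.mul (N.measurable_pathPower t n)))
  -- At `T = 0` the rescaling constant vanishes and `0 * ∞ = 0` would hide infinite interference,
  -- for which the SINR is `0`. This case is obtained as the limit of the thresholds `1 / (j + 1)`.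
  rcases eq_or_ne T 0 with rfl | hT
  · rw [ENNReal.coe_zero, measure_pos_eq_iSup, measure_pos_eq_iSup]
    exact iSup_congr fun j => hpos (by positivity)
  · exact hpos hT

end Reception

/-! ### Association and densities at the two extreme thresholds -/

namespace Params

variable (N : Params)

lemma α_inv_pos : 0 < 1 / N.α := one_div_pos.2 (by linarith [N.two_lt_α])

lemma δ_top (k : Fin 2) : N.δ (fun _ => ∞) k = 0 := by
  simp [δ, ENNReal.zero_rpow_of_pos (one_div (N.α) ▸ N.α_inv_pos : 0 < N.α⁻¹)]

lemma δ_zero (k : Fin 2) : N.δ (fun _ => 0) k = ∞ := by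
  have h : ENNReal.ofReal (N.P k) ≠ 0 := by simpa using N.P_pos k
  rw [δ, ENNReal.div_zero h, ENNReal.top_rpow_of_pos N.α_inv_pos]

end Params

namespace BaseStations

variable {N : Params} (S : BaseStations N)

lemma measurable_D (k : Fin 2) : Measurable (S.D k) :=
  Measurable.iInf fun i => Measurable.ite ((S.Φ k).measurableSet_lt_num i)
    ((S.Φ k).measurable_pt i).norm.ennreal_ofReal measurable_const

lemma measure_count_ball_eq_zero (k : Fin 2) (ε : ℝ) :
    S.μ {ω | (S.Φ k).count (Metric.ball 0 ε) ω = 0} =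
      expNeg (ENNReal.ofReal (N.lam k) * ENNReal.ofReal Real.pi * ENNReal.ofReal ε ^ 2) := by
  have h : (ENNReal.ofReal (N.lam k) • (volume : Measure Plane)) (Metric.ball 0 ε) =
      ENNReal.ofReal (N.lam k) * ENNReal.ofReal Real.pi * ENNReal.ofReal ε ^ 2 := by
    rw [Measure.smul_apply, EuclideanSpace.volume_ball_fin_two, smul_eq_mul, mul_right_comm,
      mul_assoc]
  rw [(S.poisson k).measure_count_eq_zero measurableSet_ball, h]
  rw [h]
  finiteness

lemma D_lt_of_count_ball_ne_zero {k : Fin 2} {ε : ℝ} {ω : S.Ω}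
    (h : (S.Φ k).count (Metric.ball 0 ε) ω ≠ 0) : S.D k ω < ENNReal.ofReal ε := by
  obtain ⟨i, hi, hx⟩ := Set.encard_ne_zero.1 h
  refine (iInf_le _ i).trans_lt ?_
  rw [if_pos hi]
  rw [mem_ball_zero_iff] at hx
  exact (ENNReal.ofReal_lt_ofReal_iff ((norm_nonneg _).trans_lt hx)).2 hx

lemma ofReal_le_D_of_count_ball_eq_zero {k : Fin 2} {ε : ℝ} {ω : S.Ω}
    (h : (S.Φ k).count (Metric.ball 0 ε) ω = 0) : ENNReal.ofReal ε ≤ S.D k ω := by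
  refine le_iInf fun i => ?_
  split_ifs with hi
  · refine ENNReal.ofReal_le_ofReal (not_lt.1 fun hx => ?_)
    exact Set.eq_empty_iff_forall_notMem.1 (Set.encard_eq_zero.1 h) i
      ⟨hi, mem_ball_zero_iff.2 hx⟩
  · exact le_top

/-- The void probabilities of growing balls tend to `0`. -/
lemma ae_D_ne_top (k : Fin 2) : ∀ᵐ ω ∂S.μ, S.D k ω ≠ ∞ := by
  have hC : ENNReal.ofReal (N.lam k) * ENNReal.ofReal Real.pi ≠ 0 := by
    simp [N.lam_pos k, Real.pi_pos]
  have hle (n : ℕ) : S.μ {ω | S.D k ω = ∞} ≤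
      expNeg (ENNReal.ofReal (N.lam k) * ENNReal.ofReal Real.pi * (n : ℝ≥0∞) ^ 2) := by
    rw [← ENNReal.ofReal_natCast, ← S.measure_count_ball_eq_zero]
    refine measure_mono fun ω hω => ?_
    by_contra h
    exact (S.D_lt_of_count_ball_ne_zero h).not_ge (le_top.trans_eq (Eq.symm hω))
  have hlim : Filter.Tendsto
      (fun n : ℕ => expNeg (ENNReal.ofReal (N.lam k) * ENNReal.ofReal Real.pi * (n : ℝ≥0∞) ^ 2))
      Filter.atTop (nhds 0) := by
    have h := ENNReal.Tendsto.const_mul (a := ENNReal.ofReal (N.lam k) * ENNReal.ofReal Real.pi)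
      (ENNReal.Tendsto.pow (n := 2) ENNReal.tendsto_nat_nhds_top) (Or.inl (by simp))
    rw [ENNReal.top_pow two_ne_zero, ENNReal.mul_top hC] at h
    simpa [Function.comp_def] using (continuous_expNeg.tendsto _).comp h
  rw [ae_iff]
  simpa using ge_of_tendsto' hlim hle

/-- The probability that a ball around the origin contains a point tends to `0` as the ball shrinks.
-/
lemma ae_D_ne_zero (k : Fin 2) : ∀ᵐ ω ∂S.μ, S.D k ω ≠ 0 := by
  have hle (n : ℕ) : S.μ {ω | S.D k ω = 0} ≤
      1 - expNeg (ENNReal.ofReal (N.lam k) * ENNReal.ofReal Real.pi *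
        ENNReal.ofReal (1 / ((n : ℝ) + 1)) ^ 2) := by
    have hm : MeasurableSet {ω | (S.Φ k).count (Metric.ball 0 (1 / ((n : ℝ) + 1))) ω = 0} :=
      (S.Φ k).measurable_count measurableSet_ball (measurableSet_singleton 0)
    rw [← S.measure_count_ball_eq_zero, ← prob_compl_eq_one_sub hm]
    refine measure_mono fun ω hω h => ?_
    have h1 := S.ofReal_le_D_of_count_ball_eq_zero h
    rw [show S.D k ω = 0 from hω, nonpos_iff_eq_zero, ENNReal.ofReal_eq_zero] at h1
    exact h1.not_gt (by positivity)
  have hlim : Filter.Tendsto (fun n : ℕ => 1 - expNeg (ENNReal.ofReal (N.lam k) * ENNReal.ofReal Real.pi *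
        ENNReal.ofReal (1 / ((n : ℝ) + 1)) ^ 2)) Filter.atTop (nhds 0) := by
    have h0 := (ENNReal.continuous_ofReal.tendsto 0).comp
      (tendsto_one_div_add_atTop_nhds_zero_nat (𝕜 := ℝ))
    have h := ENNReal.Tendsto.const_mul (a := ENNReal.ofReal (N.lam k) * ENNReal.ofReal Real.pi)
      (ENNReal.Tendsto.pow (n := 2) h0) (Or.inr (by finiteness))
    have h2 := ((ENNReal.continuous_sub_left ENNReal.one_ne_top).tendsto _).comp
      ((continuous_expNeg.tendsto _).comp h)
    simpa [Function.comp_def] using h2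
  rw [ae_iff]
  simpa using ge_of_tendsto' hlim hle

/-- The mode conditions become `0 < D k` and `D k ≤ ∞`, which differ only on the null event `D k =
0`. -/
lemma assocEvent_HD_top_ae_eq (k : Fin 2) :
    S.assocEvent (fun _ => ∞) k .HD =ᵐ[S.μ] S.assocEvent (fun _ => 0) k .FD := by
  filter_upwards [S.ae_D_ne_zero k] with ω hω
  refine propext ?_
  change (_ ∧ _) ↔ (_ ∧ _)
  rw [N.δ_top, N.δ_zero]
  simp [pos_iff_ne_zero, hω]

lemma assocProb_HD_top (k : Fin 2) :
    S.assocProb (fun _ => ∞) k .HD = S.assocProb (fun _ => 0) k .FD :=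
  measureReal_congr (S.assocEvent_HD_top_ae_eq k)

lemma assocProb_FD_top (k : Fin 2) : S.assocProb (fun _ => ∞) k .FD = 0 := by
  rw [assocProb, measureReal_eq_zero_iff]
  refine measure_mono_null (fun ω hω => ?_) (ae_iff.1 (S.ae_D_ne_zero k))
  have h : S.D k ω ≤ N.δ (fun _ => ∞) k := hω.2
  rw [N.δ_top] at h
  exact not_not.2 (nonpos_iff_eq_zero.1 h)

lemma assocProb_HD_zero (k : Fin 2) : S.assocProb (fun _ => 0) k .HD = 0 := by
  have : S.assocEvent (fun _ => 0) k .HD = ∅ := by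
    refine Set.eq_empty_of_forall_notMem fun ω hω => ?_
    have h : N.δ (fun _ => 0) k < S.D k ω := hω.2
    rw [N.δ_zero] at h
    exact not_top_lt h
  simp [assocProb, this]

lemma distLaw_HD_top (k : Fin 2) :
    S.distLaw (fun _ => ∞) k .HD = S.distLaw (fun _ => 0) k .FD := by
  have h := S.assocEvent_HD_top_ae_eq k
  rw [distLaw, distLaw, ProbabilityTheory.cond, ProbabilityTheory.cond, measure_congr h,
    Measure.restrict_congr_set h]

lemma modeDensity_FD_top (t : Fin 2) : S.modeDensity (fun _ => ∞) t .FD = 0 := by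
  simp [modeDensity, assocProb_FD_top]

lemma modeDensity_HD_top (t : Fin 2) :
    S.modeDensity (fun _ => ∞) t .HD = S.modeDensity (fun _ => 0) t .FD := by
  simp [modeDensity, assocProb_FD_top, assocProb_HD_zero, assocProb_HD_top]

/-- The model of the reception is specified only for `r > 0`. An infinite distance must be excluded
too, since `toReal` would send it to `0`. -/
lemma ae_distLaw_pos (γ : Fin 2 → ℝ≥0∞) (k : Fin 2) (m : Mode) :
    ∀ᵐ r ∂S.distLaw γ k m, 0 < r := by
  rw [distLaw, ae_map_iff (S.measurable_D k).ennreal_toReal.aemeasurable measurableSet_Ioi]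
  refine cond_absolutelyContinuous.ae_le ?_
  filter_upwards [S.ae_D_ne_zero k, S.ae_D_ne_top k] with ω h0 h1
  exact ENNReal.toReal_pos h0 h1

instance (γ : Fin 2 → ℝ≥0∞) (k : Fin 2) (m : Mode) : IsFiniteMeasure (S.distLaw γ k m) := by
  unfold distLaw
  infer_instance

end BaseStations

/-! ### Intensities of the interferers at the extreme thresholds -/

variable {N : Params} {S : BaseStations N}

lemma oneSubExpNeg_le_one (x : ℝ≥0∞) : oneSubExpNeg x ≤ 1 := tsub_le_self

lemma intensityFn_le (γ : Fin 2 → ℝ≥0∞) (d : Link) (k t : Fin 2) (r y : ℝ) (n : Node)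
    (m : Mode) : intensityFn S γ d k t r y n m ≤ ENNReal.ofReal (S.modeDensity γ t m) := by
  cases n <;> cases m <;> simp only [intensityFn] <;> try split_ifs
  all_goals first
    | exact zero_le
    | exact mul_le_of_le_one_right' (oneSubExpNeg_le_one _)

lemma allowedFraction_le_one (γ : Fin 2 → ℝ≥0∞) (d : Link) (k t : Fin 2) (r y : ℝ) (n : Node)
    (m : Mode) : allowedFraction N γ d k t r y n m ≤ 1 := by
  have h : ENNReal.ofReal (pI N k t) ≤ 1 :=
    ENNReal.ofReal_le_one.2 (sub_le_self _ (sq_nonneg _))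
  cases d <;> cases n <;> cases m <;> simp only [allowedFraction] <;> split_ifs
  all_goals first
    | exact zero_le
    | exact le_rfl
    | exact h

/-- The density is bounded by the mode density, so balls have finite mass. -/
instance sigmaFinite_intensity (γ : Fin 2 → ℝ≥0∞) (d : Link) (k t : Fin 2) (n : Node)
    (m : Mode) (r : ℝ) : SigmaFinite (intensity S γ d k t n m r) := by
  refine ⟨⟨⟨fun j : ℕ => Metric.ball 0 j, fun _ => trivial, fun j => ?_, Metric.iUnion_ball_nat _⟩⟩⟩
  rw [intensity, withDensity_apply _ measurableSet_ball]
  refine (lintegral_mono (g := fun _ => ENNReal.ofReal (S.modeDensity γ t m)) fun x =>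
    mul_le_of_le_one_of_le (allowedFraction_le_one _ _ _ _ _ _ _ _)
      (intensityFn_le _ _ _ _ _ _ _ _)).trans_lt ?_
  rw [lintegral_const, Measure.restrict_apply_univ]
  exact ENNReal.mul_lt_top ENNReal.ofReal_lt_top measure_ball_lt_top

lemma intensity_FD_top (d : Link) (k t : Fin 2) (n : Node) (r : ℝ) :
    intensity S (fun _ => ∞) d k t n .FD r = 0 := by
  cases n <;> simp [intensity, intensityFn, S.modeDensity_FD_top]

lemma oneSubExpNeg_zero : oneSubExpNeg 0 = 0 := by simp [oneSubExpNeg]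

lemma intensity_bs_HD_top (d : Link) (k t : Fin 2) (r : ℝ) :
    intensity S (fun _ => ∞) d k t .bs .HD r = intensity S (fun _ => 0) d k t .bs .FD r := by
  unfold intensity
  congr 1
  funext x
  congr 1
  · cases d <;> rfl
  · simp only [intensityFn, N.δ_top, S.modeDensity_HD_top, nonpos_iff_eq_zero]
    -- The cutoff for half-duplex base stations is now `ζ = 0`, where the full-duplex intensity
    -- vanishes as well.
    split_ifs with h
    · simp [h, oneSubExpNeg_zero]
    · simp

/-- Both exclusion radii are `0`: one is a multiple of `δ = 0`, the other a truncated difference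
with `δ = ∞` subtracted. -/
lemma intensity_user_up_HD_top (k t : Fin 2) (r : ℝ) :
    intensity S (fun _ => ∞) .up k t .user .HD r = intensity S (fun _ => 0) .up k t .user .FD r := by
  simp only [intensity, intensityFn, allowedFraction, N.δ_top, N.δ_zero, S.modeDensity_HD_top]
  simp

/-! ### Comparison of the two networks -/

namespace Reception

variable {γ : Fin 2 → ℝ≥0∞} {d : Link} {k : Fin 2} (M : Reception S γ d k)

lemma measurable_interference (t : Fin 2) (c : Channel) :
    Measurable fun ω => M.interference t ω c := by
  cases c <;> exact ((M.measurable_power _ _ _).add (M.measurable_power _ _ _)).add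
    (M.measurable_power _ _ _)

lemma measurable_sinr (m : Mode) (c : Channel) :
    Measurable fun q : ℝ × M.Ω => M.sinr m c q.1 q.2 := by
  unfold sinr
  have h1 : Measurable fun q : ℝ × M.Ω => M.h₀ q.2 := M.measurable_h₀.comp measurable_snd
  have h2 (t : Fin 2) : Measurable fun q : ℝ × M.Ω => M.interference t q.2 c :=
    (M.measurable_interference t c).comp measurable_snd
  fun_prop

lemma tierCoverage_eq (m : Mode) (c : Channel) (T : ℝ≥0) : M.tierCoverage m c T =
    (∫⁻ r, M.law r {ω | (T : ℝ≥0∞) < M.sinr m c r ω} ∂S.distLaw γ k m).toReal := by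
  rw [tierCoverage, measureReal_def, Measure.compProd_apply
    (measurableSet_lt measurable_const (M.measurable_sinr m c))]
  rfl

/-- Full-duplex base stations and users interfere on either channel, so `n` is arbitrary and the
dropped terms only enlarge the denominator. -/
lemma sinr_FD_le (n : Node) (c : Channel) (r : ℝ) (ω : M.Ω) :
    M.sinr .FD c r ω ≤ M.partialSinr n .FD r ω := by
  refine ENNReal.div_le_div_left (add_le_add_left ?_ _) _
  refine le_add_left (Finset.sum_le_sum fun t _ => ?_)
  cases c <;> cases n
  · exact le_self_add.trans le_self_add
  · exact (le_add_left le_rfl).trans le_self_add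
  · exact le_self_add.trans le_self_add
  · exact (le_add_left le_rfl).trans le_self_add

lemma ae_power_eq_zero {r : ℝ} (hr : 0 < r) {t : Fin 2} {n : Node} {m : Mode}
    (h : intensity S γ d k t n m r = 0) : ∀ᵐ ω ∂M.law r, M.power t n m ω = 0 := by
  have hP := M.poisson r hr t n m
  rw [h] at hP
  filter_upwards [hP.ae_num_eq_zero] with ω hω
  simp [power, hω]

/-- With half-duplex scheduling only, the interference comes from the half-duplex nodes. -/
lemma ae_sinr_HD_eq (M : Reception S (fun _ => ∞) d k) {r : ℝ} (hr : 0 < r) {n : Node}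
    {c : Channel} (hc : ∀ t ω, M.interference t ω c =
      M.power t .bs .FD ω + M.power t .user .FD ω + M.power t n .HD ω) :
    ∀ᵐ ω ∂M.law r, M.sinr .HD c r ω = M.partialSinr n .HD r ω := by
  have h (t : Fin 2) (n : Node) := M.ae_power_eq_zero hr (intensity_FD_top d k t n r)
  filter_upwards [ae_all_iff.2 fun t => h t .bs, ae_all_iff.2 fun t => h t .user] with ω h1 h2
  simp only [sinr, partialSinr, hc, h1, h2, zero_add]
  cases d <;> simp [Params.selfInterference]

/-- Compares conditionally on the common transmit distance, with `partialSinr` as the link between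
the two sample spaces. -/
lemma tierCoverage_FD_le_HD (MF : Reception S (fun _ => 0) d k)
    (MH : Reception S (fun _ => ∞) d k) {n : Node} (c : Channel) {c' : Channel}
    (hc : ∀ t ω, MH.interference t ω c' =
      MH.power t .bs .FD ω + MH.power t .user .FD ω + MH.power t n .HD ω)
    (hint : ∀ t r, intensity S (fun _ => ∞) d k t n .HD r = intensity S (fun _ => 0) d k t n .FD r)
    (T : ℝ≥0) : MF.tierCoverage .FD c T ≤ MH.tierCoverage .HD c' T := by
  rw [tierCoverage_eq, tierCoverage_eq, S.distLaw_HD_top]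
  refine ENNReal.toReal_mono ?_ (lintegral_mono_ae ?_)
  · refine ((lintegral_mono fun r => prob_le_one).trans_lt (?_ : ∫⁻ _, 1 ∂_ < ∞)).ne
    simp
  filter_upwards [S.ae_distLaw_pos (fun _ => 0) k .FD] with r hr
  calc MF.law r {ω | (T : ℝ≥0∞) < MF.sinr .FD c r ω}
      ≤ MF.law r {ω | (T : ℝ≥0∞) < MF.partialSinr n .FD r ω} :=
        measure_mono fun ω hω => lt_of_lt_of_le hω (MF.sinr_FD_le n c r ω)
    _ = MH.law r {ω | (T : ℝ≥0∞) < MH.partialSinr n .HD r ω} :=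
        MF.law_lt_partialSinr_congr MH hr (fun t => inferInstance) (fun t => (hint t r).symm) T
    _ = MH.law r {ω | (T : ℝ≥0∞) < MH.sinr .HD c' r ω} := by
        refine measure_congr ?_
        filter_upwards [MH.ae_sinr_HD_eq hr hc] with ω hω
        refine propext ?_
        change _ < _ ↔ _ < _
        rw [hω]

end Reception

/-- Both averages over the tiers use the same nonnegative weights and the same denominator. -/
lemma coverage_FD_le_HD {d : Link} (MF : ∀ k, Reception S (fun _ => 0) d k)
    (MH : ∀ k, Reception S (fun _ => ∞) d k) {c c' : Channel} {T : ℝ≥0}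
    (h : ∀ k, (MF k).tierCoverage .FD c T ≤ (MH k).tierCoverage .HD c' T) :
    coverage MF .FD c T ≤ coverage MH .HD c' T := by
  unfold coverage
  simp_rw [S.assocProb_HD_top]
  have h0 (k : Fin 2) : 0 ≤ S.assocProb (fun _ => 0) k .FD := measureReal_nonneg
  exact div_le_div_of_nonneg_right
    (Finset.sum_le_sum fun k _ => mul_le_mul_of_nonneg_left (h k) (h0 k))
    (Finset.sum_nonneg fun k _ => h0 k)

end

end HetNet

theorem corollary1 (N : HetNet.Params) (S : HetNet.BaseStations N)
    (MHD : HetNet.Receptions S (fun _ => ∞)) (MFD : HetNet.Receptions S (fun _ => 0))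
    (T : ℝ≥0) (i : HetNet.Channel) :
    HetNet.coverageFDDown MFD i T ≤ HetNet.coverageHD MHD .ch1 T ∧
    HetNet.coverageFDUp MFD i T ≤ HetNet.coverageHD MHD .ch2 T := by
  refine ⟨HetNet.coverage_FD_le_HD _ _ fun k => ?_, HetNet.coverage_FD_le_HD _ _ fun k => ?_⟩
  · exact HetNet.Reception.tierCoverage_FD_le_HD _ _ (n := .bs) i (fun _ _ => rfl)
      (fun t r => HetNet.intensity_bs_HD_top _ _ _ _) T
  · exact HetNet.Reception.tierCoverage_FD_le_HD _ _ (n := .user) i (fun _ _ => rfl)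
      (fun t r => HetNet.intensity_user_up_HD_top _ _ _) T
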